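/- Write $n=\{0,\dots,n-1\}$. A \emph{type-space functor} $S$ assigns to each $n<\omega$ a topological space $S_n$ and to each function $f:n\to m$ a continuous map $Sf:S_m\to S_n$, open whenever $f$ is injective, such that $S(\mathrm{id})=\mathrm{id}$, $S(g\circ f)=Sf\circ Sg$, and weak amalgamation holds: with $i_k:k\to k+1$ the inclusion and $d_m:m+1\to m+2$ given by $d_m(j)=j$ for $j<m$ and $d_m(m)=m+1$, for all $p\in S_m$, $q\in(Si_m)^{-1}(p)$ and non-empty relatively open $U\subseteq (Si_m)^{-1}(p)$ there is $r\in S_{m+2}$ with $(Si_{m+1})(r)=q$ and $(Sd_m)(r)\in U$. Let $\iota_{n,m}:n\to m$ be the inclusion, and let $S_\omega=\{(a_n)_n\in\prod_n S_n: a_n=(S\iota_{n,m})(a_m)\text{ for } n\le m\}$ with the subspace topology; for $f:n\to\omega$ and $\sigma=(\sigma_j)_j\in S_\omega$ put $(Sf)(\sigma)=(Sf)(\sigma_m)$ for any $m$ such that $f$ maps into $m$. A \emph{countable model} of $S$ is a function $M$ on the finite subsets of $\omega$ such that for all $n\le m<\omega$ and $A=\{a_0<\dots<a_{n-1}\}\subseteq\omega$: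 (1) $M(A)\in S_n$; (2) if $A\subseteq B=\{b_0<\dots<b_{k-1}\}\subseteq\omega$ and $a_i=b_{g(i)}$ for all $i<n$, where $g:n\to k$, then $M(A)=(Sg)(M(B))$; (3) for each non-empty relatively open $U\subseteq (S\iota_{n,m})^{-1}(M(A))$ there are $B=\{b_0<\dots<b_{m-1}\}\supseteq A$ and a permutation $g$ of $m$ with $a_i=b_{g(i)}$ for $i<n$ and $(Sg)(M(B))\in U$. Its $\omega$-type is $\sigma_M=(M(\{0,\dots,n-1\}))_n\in S_\omega$. For $\sigma \in S_\omega$ let $M_\sigma(\{a_0<\dots<a_{n-1}\})=(S(i\mapsto a_i))(\sigma)$, and let $S_{\mathcal W}$ be the set of those $\sigma\in S_\omega$ for which $M_\sigma$ is a model (equivalently, $S_{\mathcal W}$ is the set of all $\sigma_M$). Say that $M$ \emph{realizes} (or is in) $C\subseteq S_\omega$ if $\sigma_M\in C$, and \emph{omits} $E\subseteq S_\omega$ if $\sigma_M\notin E$. $S$ has the \emph{strong omitting types property} if for every closed $C\subseteq S_\omega$ with $C\cap S_{\mathcal W}\ne\emptyset$ and every $E\subseteq C$ such that $E\cap S_{\mathcal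 W}$ is meagre in $C\cap S_{\mathcal W}$, there is a countable model in $C$ omitting $E$. For a closed set $C\subseteq S_\omega$, in the \emph{omitting types game} on $C$ the players REALIZE and OMIT alternately choose closed sets $F_0\subseteq F_1\subseteq\cdots$ of $S_\omega$, with REALIZE playing first, such that each $F_i$ is omitted by some countable model realizing $C$. OMIT wins an infinite play if $\bigcup_n F_n$ is omitted by some countable model realizing $C$. $S$ has the \emph{game omitting types property} if for every closed $C\subseteq S_\omega$ OMIT has a winning strategy, that is, a rule that computes each move of OMIT from the previous moves of REALIZE, always gives a legal move, and wins every infinite play that follows it. (If no countable model realizes $C$, REALIZE has no first move, and the requirement on $C$ is void.) For a topological space $X$, the type-space functor $S(X)$ is given by $S_n=X^n$ and $(Sf)(x_0,\dots,x_{m-1})=(x_{f(0)},\dots,x_{f(n-1)})$ for $f:n\to m$. \textbf{Lemma.} Let $X$ be a separable metrizable space such that $X^\omega$ (with the product topology) is completely Baire, i.e. each closed subspace of $X^\omega$ is a Baire space, but no dense subspace of $X^\omega$ is completely metrizable. Then the type-space functor $S(X)$ has the strong omitting types property but does not have the game omitting types property. -/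

import Mathlib

universe u v

/-- A space is completely Baire if each of its closed subspaces is a Baire space. -/
def CompletelyBaire (Y : Type u) [TopologicalSpace Y] : Prop :=
  ∀ F : Set Y, IsClosed F → BaireSpace F

/-- Some dense subspace of `Y` is completely metrizable. -/
def HasDenseCompletelyMetrizableSubspace (Y : Type u) [TopologicalSpace Y] : Prop :=
  ∃ D : Set Y, Dense D ∧ TopologicalSpace.IsCompletelyMetrizableSpace D

/-- The map `d : m + 1 → m + 2` that fixes each `j < m` and sends `m` to `m + 1`. -/
def amalgMap (m : ℕ) (j : Fin (m + 1)) : Fin (m + 2) :=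
  if j.val < m then j.castSucc else Fin.last (m + 1)

/-- A type-space functor: a contravariant functor from the finite ordinals `n = {0, …, n - 1}` and
all functions between them to topological spaces, with weak amalgamation. The maps induced by
injections are required to be open. (Openness is not required for non-injective functions: for
the functor `n ↦ X ^ n` the function `2 → 1` induces the diagonal embedding of `X` into `X ^ 2`,
which is open only for discrete `X`.) -/
structure TypeSpaceFunctor where
  /-- the space `S n` of `n`-types -/
  obj : ℕ → Type u
  [top : ∀ n, TopologicalSpace (obj n)]
  /-- the map `S f : S m → S n` for `f : n → m` -/
  map : ∀ {n m : ℕ}, (Fin n → Fin m) → obj m → obj n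
  continuous_map : ∀ {n m : ℕ} (f : Fin n → Fin m), Continuous (map f)
  isOpenMap_map : ∀ {n m : ℕ} (f : Fin n → Fin m), Function.Injective f → IsOpenMap (map f)
  map_id : ∀ (n : ℕ) (p : obj n), map (id : Fin n → Fin n) p = p
  map_comp : ∀ {n m k : ℕ} (f : Fin n → Fin m) (g : Fin m → Fin k) (p : obj k),
    map (g ∘ f) p = map f (map g p)
  /-- Weak amalgamation. A non-empty open subset of the fibre over `p` is given as the trace on
  the fibre of an open set `U` that meets the fibre; the point `map (amalgMap m) r` always lies in
  the fibre. -/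
  weak_amalgamation : ∀ (m : ℕ) (p : obj m) (q : obj (m + 1)), map Fin.castSucc q = p →
    ∀ U : Set (obj (m + 1)), IsOpen U → (∃ u ∈ U, map Fin.castSucc u = p) →
      ∃ r : obj (m + 2), map Fin.castSucc r = q ∧ map (amalgMap m) r ∈ U

attribute [instance] TypeSpaceFunctor.top

namespace TypeSpaceFunctor

/-- The inverse limit of the spaces `S n` along the maps induced by the inclusions `n → m`,
with the subspace topology from the product. -/
def Omega (S : TypeSpaceFunctor.{u}) : Type u :=
  {a : ∀ n, S.obj n // ∀ (n m : ℕ) (h : n ≤ m), a n = S.map (Fin.castLE h) (a m)}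

instance (S : TypeSpaceFunctor.{u}) : TopologicalSpace S.Omega :=
  inferInstanceAs (TopologicalSpace
    {a : ∀ n, S.obj n // ∀ (n m : ℕ) (h : n ≤ m), a n = S.map (Fin.castLE h) (a m)})

/-- A natural number strictly above all values of `f`. -/
def bound {n : ℕ} (f : Fin n → ℕ) : ℕ := Finset.univ.sup f + 1

theorem lt_bound {n : ℕ} (f : Fin n → ℕ) (i : Fin n) : f i < bound f :=
  Nat.lt_succ_of_le (Finset.le_sup (f := f) (Finset.mem_univ i))

/-- The map from the inverse limit to `S n` induced by `f : n → ω`. -/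
def mapOmega (S : TypeSpaceFunctor.{u}) {n : ℕ} (f : Fin n → ℕ) (σ : S.Omega) : S.obj n :=
  S.map (fun i => (⟨f i, lt_bound f i⟩ : Fin (bound f))) (σ.1 (bound f))

/-- The value of `mapOmega` does not depend on the bound that is used. -/
theorem mapOmega_eq (S : TypeSpaceFunctor.{u}) {n : ℕ} (f : Fin n → ℕ) (σ : S.Omega)
    (m : ℕ) (hm : ∀ i, f i < m) :
    S.mapOmega f σ = S.map (fun i => (⟨f i, hm i⟩ : Fin m)) (σ.1 m) := by
  unfold mapOmega
  rw [σ.2 (bound f) (max (bound f) m) (le_max_left _ _), σ.2 m (max (bound f) m) (le_max_right _ _),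
    ← S.map_comp, ← S.map_comp]
  rfl

/-- `IsModel M` says that `M` is a model whose elements are indexed by the linear order `I` (a
cardinal). A set `{a 0 < … < a (n - 1)}` of `n` elements of `I` is given by its increasing
enumeration, an order embedding `a : Fin n ↪o I`; so `M` assigns to each `n`-element subset of `I`
a point of `S n`. In the last clause, a non-empty open subset of the fibre over `M a` is given
as the trace on the fibre of an open set `U` that meets the fibre. -/
structure IsModel (S : TypeSpaceFunctor.{u}) {I : Type v} [LinearOrder I]
    (M : ∀ n : ℕ, (Fin n ↪o I) → S.obj n) : Prop where
  coherent : ∀ {n m : ℕ} (a : Fin n ↪o I) (b : Fin m ↪o I) (g : Fin n → Fin m),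
    (∀ i, a i = b (g i)) → M n a = S.map g (M m b)
  witness : ∀ {n m : ℕ} (h : n ≤ m) (a : Fin n ↪o I) (U : Set (S.obj m)), IsOpen U →
    (∃ p ∈ U, S.map (Fin.castLE h) p = M n a) →
      ∃ (b : Fin m ↪o I) (g : Equiv.Perm (Fin m)),
        (∀ i : Fin n, a i = b (g (Fin.castLE h i))) ∧ S.map g (M m b) ∈ U

/-- The countable models: the models of size `ω`. -/
structure CountableModel (S : TypeSpaceFunctor.{u}) where
  toFun : ∀ n : ℕ, (Fin n ↪o ℕ) → S.obj n
  isModel : S.IsModel toFun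

/-- The increasing enumeration of `{0, …, n - 1}` as a subset of `ω`. -/
def initialSegment (n : ℕ) : Fin n ↪o ℕ := Fin.valOrderEmb n

/-- The `ω`-type `σ_M = (M {0, …, n - 1})_n` of a countable model `M`. -/
def CountableModel.omegaType {S : TypeSpaceFunctor.{u}} (M : S.CountableModel) : S.Omega :=
  ⟨fun n => M.toFun n (initialSegment n), fun n m h =>
    M.isModel.coherent (initialSegment n) (initialSegment m) (Fin.castLE h) (fun _ => rfl)⟩

/-- The function `M_σ` on finite subsets of `ω` that is determined by `σ`. -/
def modelOf (S : TypeSpaceFunctor.{u}) (σ : S.Omega) (n : ℕ) (a : Fin n ↪o ℕ) : S.obj n :=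
  S.mapOmega a σ

/-- The set of those `σ` for which `M_σ` is a model. -/
def W (S : TypeSpaceFunctor.{u}) : Set S.Omega :=
  {σ | S.IsModel (S.modelOf σ)}

theorem CountableModel.modelOf_omegaType {S : TypeSpaceFunctor.{u}} (M : S.CountableModel) :
    S.modelOf M.omegaType = M.toFun := by
  funext n a
  exact (M.isModel.coherent a (initialSegment (bound a)) _ (fun _ => rfl)).symm

/-- The elements of `W` are exactly the `ω`-types of countable models. -/
theorem mem_W_iff (S : TypeSpaceFunctor.{u}) (σ : S.Omega) :
    σ ∈ S.W ↔ ∃ M : S.CountableModel, M.omegaType = σ := by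
  constructor
  · intro h
    refine ⟨⟨S.modelOf σ, h⟩, Subtype.ext (funext fun n => ?_)⟩
    change S.mapOmega (initialSegment n) σ = σ.1 n
    rw [S.mapOmega_eq (initialSegment n) σ n (fun i => i.2)]
    exact S.map_id n _
  · rintro ⟨M, rfl⟩
    change S.IsModel (S.modelOf M.omegaType)
    rw [M.modelOf_omegaType]
    exact M.isModel

/-- Strong omitting types property: whenever the closed set `C` is realized by some countable
model and `E ⊆ C` is a set whose trace on `C ∩ W` is meagre in the space `C ∩ W`, there is a
countable model in `C` that omits `E`. -/
def StrongOmittingTypes (S : TypeSpaceFunctor.{u}) : Prop :=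
  ∀ C : Set S.Omega, IsClosed C → (C ∩ S.W).Nonempty →
    ∀ E : Set S.Omega, E ⊆ C → IsMeagre {x : ↥(C ∩ S.W) | x.1 ∈ E} →
      ∃ M : S.CountableModel, M.omegaType ∈ C ∧ M.omegaType ∉ E

/-- `F` is omissible in a (countable) model realizing `C`. -/
def Omissible (S : TypeSpaceFunctor.{u}) (C F : Set S.Omega) : Prop :=
  ∃ M : S.CountableModel, M.omegaType ∈ C ∧ M.omegaType ∉ F

/-- The sets that may be played in the omitting types game on `C`: partial `ω`-types (closed sets)
that are omissible in a model realizing `C`. -/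
def Move (S : TypeSpaceFunctor.{u}) (C : Set S.Omega) : Type u :=
  {F : Set S.Omega // IsClosed F ∧ S.Omissible C F}

/-- A strategy for OMIT in the game on `C`: the reply to the moves `R 0, …, R n` of REALIZE. -/
def OmitStrategy (S : TypeSpaceFunctor.{u}) (C : Set S.Omega) : Type u :=
  ∀ n : ℕ, (Fin (n + 1) → S.Move C) → S.Move C

/-- The `n`-th move of OMIT when OMIT follows `τ` and REALIZE plays `R 0, R 1, …`. -/
def OmitStrategy.reply {S : TypeSpaceFunctor.{u}} {C : Set S.Omega} (τ : S.OmitStrategy C)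
    (R : ℕ → S.Move C) (n : ℕ) : S.Move C :=
  τ n (fun i => R i)

/-- The strategy `τ` is winning for OMIT: as long as REALIZE plays sets that contain the previous
move, the replies given by `τ` contain the previous move, and in each infinite play
`R 0 ⊆ reply 0 ⊆ R 1 ⊆ reply 1 ⊆ …` that follows `τ` the union of all moves is omissible in a
model realizing `C`. -/
def OmitStrategy.IsWinning {S : TypeSpaceFunctor.{u}} {C : Set S.Omega}
    (τ : S.OmitStrategy C) : Prop :=
  ∀ R : ℕ → S.Move C,
    (∀ n, (∀ k < n, (τ.reply R k).1 ⊆ (R (k + 1)).1) → (R n).1 ⊆ (τ.reply R n).1) ∧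
    ((∀ k, (τ.reply R k).1 ⊆ (R (k + 1)).1) →
      S.Omissible C (⋃ n, ((R n).1 ∪ (τ.reply R n).1)))

/-- Game omitting types property: OMIT has a winning strategy in the omitting types game on every
closed set `C`. (If no countable model realizes `C`, then REALIZE has no first move.) -/
def GameOmittingTypes (S : TypeSpaceFunctor.{u}) : Prop :=
  ∀ C : Set S.Omega, IsClosed C → ∃ τ : S.OmitStrategy C, τ.IsWinning

/-- The type-space functor `n ↦ X ^ n` of a topological space `X`. -/
def ofSpace (X : Type u) [TopologicalSpace X] : TypeSpaceFunctor.{u} where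
  obj n := Fin n → X
  map f x := x ∘ f
  continuous_map f := by fun_prop
  isOpenMap_map {n m} f hf := by
    refine IsOpenMap.of_sections fun x => ⟨fun y => Function.extend f y x, ?_, ?_, fun y => ?_⟩
    · refine Continuous.continuousAt (continuous_pi fun j => ?_)
      by_cases hj : ∃ i, f i = j
      · obtain ⟨i, rfl⟩ := hj
        simpa only [hf.extend_apply] using continuous_apply i
      · simpa only [Function.extend_apply' _ _ _ hj] using continuous_const
    · funext j
      by_cases hj : ∃ i, f i = j
      · obtain ⟨i, rfl⟩ := hj
        simp [hf.extend_apply]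
      · simp [Function.extend_apply' _ _ _ hj]
    · exact Function.extend_comp hf y x
  map_id _ _ := rfl
  map_comp _ _ _ := rfl
  weak_amalgamation m p q hq U _ := by
    rintro ⟨u, hu, hup⟩
    refine ⟨Fin.snoc (α := fun _ => X) q (u (Fin.last m)), ?_, ?_⟩
    · funext i
      simp
    · have : (Fin.snoc (α := fun _ => X) q (u (Fin.last m))) ∘ amalgMap m = u := by
        funext j
        refine Fin.lastCases ?_ (fun i => ?_) j
        · simp [amalgMap]
        · have h := congrFun (hup.trans hq.symm) i
          simp only [Function.comp] at h
          simp [amalgMap, h]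
      change (Fin.snoc (α := fun _ => X) q (u (Fin.last m))) ∘ amalgMap m ∈ U
      rwa [this]

end TypeSpaceFunctor

open Set TopologicalSpace Topology

/-! The `ω`-types of `S(X)` are the sequences in `X`, and models correspond to those that visit
every non-empty open set infinitely often. As `X` has a countable base, these form a dense Gδ set
`W`.

Strong omitting types: for closed `C`, the set `C ∩ W` is Gδ in a completely Baire metrizable space,
hence Baire, so no meagre set covers it.

Game: take `C = univ`. By density of `W` the legal sets are the proper closed sets, so passing to
complements gives the Choquet game with OMIT as the player who wants a non-empty intersection. A
winning strategy yields a tree of positions whose open sets are disjoint on each level, shrink in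
diameter and have dense union. The points given by its branches form a dense copy of a closed
subspace of a countable power of a discrete space, which contradicts the hypothesis on `X^ω`. -/

/-! ### The Choquet game and dense completely metrizable subspaces -/

/-- Take a maximal disjoint family of small children (Zorn). If its union were not dense in `V p`,
`step` would give a further small child in the part that is missed. -/
theorem exists_pairwiseDisjoint_subset_closure {Y : Type*} [MetricSpace Y] {P : Type*}
    (V : P → Set Y) (child : P → P → Prop) (hopen : ∀ p, IsOpen (V p))
    (step : ∀ p U, IsOpen U → U.Nonempty → U ⊆ V p →
      ∃ q, child p q ∧ V q ⊆ U ∧ (V q).Nonempty) (p : P) {ε : ℝ} (hε : 0 < ε) :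
    ∃ K : Set P, (∀ q ∈ K, child p q ∧ ∀ x ∈ V q, ∀ y ∈ V q, dist x y < ε) ∧
      K.PairwiseDisjoint V ∧ V p ⊆ closure (⋃ q ∈ K, V q) := by
  let M : Set P := {q | child p q ∧ ∀ x ∈ V q, ∀ y ∈ V q, dist x y < ε}
  obtain ⟨K, hK⟩ := zorn_subset {K : Set P | K ⊆ M ∧ K.PairwiseDisjoint V} (by
    intro c hc hchain
    refine ⟨⋃₀ c, ⟨sUnion_subset fun s hs => (hc hs).1, ?_⟩, fun s hs => subset_sUnion_of_mem hs⟩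
    exact (pairwiseDisjoint_sUnion hchain.directedOn).2 fun s hs => (hc hs).2)
  refine ⟨K, fun q hq => hK.prop.1 hq, hK.prop.2, fun x hx => ?_⟩
  by_contra hx'
  obtain ⟨q, hpq, hqU, y, hy⟩ := step p
    (V p ∩ (closure (⋃ q ∈ K, V q))ᶜ ∩ Metric.ball x (ε / 2))
    (((hopen p).inter isClosed_closure.isOpen_compl).inter Metric.isOpen_ball)
    ⟨x, ⟨hx, hx'⟩, Metric.mem_ball_self (by positivity)⟩ (fun y hy => hy.1.1)
  have hdisj : ∀ r ∈ K, Disjoint (V q) (V r) := fun r hr =>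
    disjoint_left.2 fun z hz hz' => (hqU hz).1.2 (subset_closure (mem_biUnion hr hz'))
  have hmem : insert q K ∈ {K : Set P | K ⊆ M ∧ K.PairwiseDisjoint V} := by
    refine ⟨insert_subset ⟨hpq, fun a ha b hb => ?_⟩ hK.prop.1,
      hK.prop.2.insert fun r hr _ => hdisj r hr⟩
    have h1 : dist a x < ε / 2 := (hqU ha).2
    have h2 : dist b x < ε / 2 := (hqU hb).2
    linarith [dist_triangle_right a b x]
  -- Maximality puts `q` in `K`, so the non-empty set `V q` is disjoint from itself.
  have hqK : q ∈ K := hK.le_of_ge hmem (subset_insert q K) (mem_insert q K)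
  exact disjoint_left.1 (hdisj q hqK) hy hy

/-- A dense completely metrizable subspace from a winning strategy of the second player in the
Choquet game. The positions `p : P` carry the open set `V p` that was played last, and `child` is
the relation between successive positions. -/
theorem hasDenseCompletelyMetrizableSubspace_of_choquet {Y : Type*} [TopologicalSpace Y]
    [MetrizableSpace Y] [BaireSpace Y] {P : Type*} (V : P → Set Y) (child : P → P → Prop)
    (root : P) (hroot : V root = univ) (hopen : ∀ p, IsOpen (V p))
    (hmono : ∀ p q, child p q → V q ⊆ V p)
    (step : ∀ p U, IsOpen U → U.Nonempty → U ⊆ V p →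
      ∃ q, child p q ∧ V q ⊆ U ∧ (V q).Nonempty)
    (win : ∀ b : ℕ → P, b 0 = root → (∀ n, child (b n) (b (n + 1))) → ∃ x, ∀ n, x ∈ V (b n)) :
    HasDenseCompletelyMetrizableSubspace Y := by
  let := metrizableSpaceMetric Y
  choose K hKchild hKdisj hKdense using fun (n : ℕ) (p : P) =>
    exists_pairwiseDisjoint_subset_closure V child hopen step p
      (Nat.one_div_pos_of_nat (α := ℝ) (n := n))
  -- `T n` is the `n`-th level of the tree; `B` below is its set of branches.
  let T : ℕ → Set P := fun n => Nat.rec {root} (fun n s => ⋃ p ∈ s, K n p) n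
  have hTsucc : ∀ n q, q ∈ T (n + 1) ↔ ∃ p ∈ T n, q ∈ K n p := fun n q => by simp [T]
  have huniq : ∀ n, ∀ p ∈ T n, ∀ q ∈ T n, ∀ x, x ∈ V p → x ∈ V q → p = q := by
    intro n
    induction n with
    | zero =>
      intro p hp q hq _ _ _
      exact (show p = root from hp).trans (show q = root from hq).symm
    | succ n ih =>
      intro p hp q hq x hxp hxq
      obtain ⟨p', hp', hpK⟩ := (hTsucc n p).1 hp
      obtain ⟨q', hq', hqK⟩ := (hTsucc n q).1 hq
      obtain rfl := ih p' hp' q' hq' x (hmono _ _ (hKchild n p' p hpK).1 hxp)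
        (hmono _ _ (hKchild n q' q hqK).1 hxq)
      by_contra hne
      exact disjoint_left.1 (hKdisj n p' hpK hqK hne) hxp hxq
  have hDopen : ∀ n, IsOpen (⋃ p ∈ T n, V p) := fun n => isOpen_biUnion fun p _ => hopen p
  have hDdense : ∀ n, Dense (⋃ p ∈ T n, V p) := by
    intro n
    induction n with
    | zero =>
      have : (⋃ p ∈ T 0, V p) = univ := by simp [T, hroot]
      rw [this]
      exact dense_univ
    | succ n ih =>
      refine Dense.of_closure (ih.mono (iUnion₂_subset fun p hp => ?_))
      refine (hKdense n p).trans (closure_mono (iUnion₂_subset fun q hq => ?_))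
      exact subset_biUnion_of_mem (u := V) ((hTsucc n q).2 ⟨p, hp, hq⟩)
  let : TopologicalSpace P := ⊥
  have : DiscreteTopology P := ⟨rfl⟩
  let B : Set (ℕ → P) := {b | b 0 = root ∧ ∀ n, b (n + 1) ∈ K n (b n)}
  have hBclosed : IsClosed B := by
    have hB : B = (fun b : ℕ → P => b 0) ⁻¹' {root} ∩
        ⋂ n, {b : ℕ → P | b (n + 1) ∈ K n (b n)} := by
      ext b
      simp [B]
    rw [hB]
    refine (isClosed_singleton.preimage (continuous_apply 0)).inter (isClosed_iInter fun n => ?_)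
    exact (isClosed_discrete {z : P × P | z.2 ∈ K n z.1}).preimage
      (f := fun b : ℕ → P => (b n, b (n + 1))) ((continuous_apply n).prodMk (continuous_apply (n + 1)))
  have : IsCompletelyMetrizableSpace B := hBclosed.isCompletelyMetrizableSpace
  have hBT : ∀ b : B, ∀ n, b.1 n ∈ T n := by
    intro b n
    induction n with
    | zero => exact b.2.1
    | succ n ih => exact (hTsucc n _).2 ⟨_, ih, b.2.2 n⟩
  choose φ hφ using fun b : B => win b.1 b.2.1 fun n => (hKchild n _ _ (b.2.2 n)).1
  have hdist : ∀ (b : B) (n : ℕ) (x y : Y), x ∈ V (b.1 (n + 1)) → y ∈ V (b.1 (n + 1)) →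
      dist x y < 1 / ((n : ℝ) + 1) := fun b n x y hx hy =>
    (hKchild n _ _ (b.2.2 n)).2 x hx y hy
  -- Shrinking diameters make `φ` continuous; the sets `V (b n)`, open and disjoint on each level,
  -- let a point near `φ b` determine its branch up to `n`.
  have hind : IsInducing φ := by
    refine isInducing_iff_nhds.2 fun b => le_antisymm ?_ ?_
    · rw [← Filter.tendsto_iff_comap, Metric.tendsto_nhds]
      intro ε hε
      obtain ⟨n, hn⟩ := exists_nat_one_div_lt hε
      have : ∀ᶠ c : B in 𝓝 b, c.1 (n + 1) = b.1 (n + 1) :=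
        ((continuous_apply (n + 1)).comp continuous_subtype_val).continuousAt.eventually
          (isOpen_discrete {b.1 (n + 1)} |>.mem_nhds rfl)
      filter_upwards [this] with c hc
      exact (hdist b n _ _ (hc ▸ hφ c (n + 1)) (hφ b (n + 1))).trans hn
    · rw [nhds_subtype, ← Filter.map_le_iff_le_comap]
      change Filter.Tendsto (fun c : B => c.1) _ (𝓝 b.1)
      rw [tendsto_pi_nhds]
      intro n
      rw [nhds_discrete P, Filter.tendsto_pure]
      filter_upwards [Filter.preimage_mem_comap ((hopen (b.1 n)).mem_nhds (hφ b n))] with c hc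
      exact huniq n _ (hBT c n) _ (hBT b n) _ (hφ c n) hc
  refine ⟨range φ, ?_, ?_⟩
  -- A point covered at every level selects one position per level; by uniqueness these form a
  -- branch, and `φ` of it is the point.
  · refine (dense_iInter_of_isOpen_nat hDopen hDdense).mono fun x hx => ?_
    simp only [mem_iInter, mem_iUnion, exists_prop] at hx
    choose b hbT hxb using hx
    have hb : b ∈ B := by
      refine ⟨hbT 0, fun n => ?_⟩
      obtain ⟨p, hp, hpK⟩ := (hTsucc n _).1 (hbT (n + 1))
      rwa [huniq n _ (hbT n) p hp x (hxb n) (hmono _ _ (hKchild n p _ hpK).1 (hxb (n + 1)))]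
    refine ⟨⟨b, hb⟩, dist_le_zero.1 (le_of_forall_pos_lt_add fun ε hε => ?_)⟩
    obtain ⟨n, hn⟩ := exists_nat_one_div_lt hε
    rw [zero_add]
    exact (hdist ⟨b, hb⟩ n _ _ (hφ ⟨b, hb⟩ (n + 1)) (hxb (n + 1))).trans hn
  · exact hind.isEmbedding.toHomeomorph.symm.isClosedEmbedding.IsCompletelyMetrizableSpace

/-! ### Completely Baire spaces -/

/-- A Gδ set in a completely Baire space is a Baire space. -/
theorem CompletelyBaire.baireSpace_of_isGδ {Y : Type*} [TopologicalSpace Y]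
    (hY : CompletelyBaire Y) {s : Set Y} (hs : IsGδ s) : BaireSpace s := by
  have : BaireSpace (closure s) := hY _ isClosed_closure
  have : BaireSpace ((↑) ⁻¹' s : Set (closure s)) :=
    (hs.preimage continuous_subtype_val).baireSpace_of_dense
      (by simp [Subtype.dense_iff, inter_eq_right.mpr subset_closure])
  have e : ((↑) ⁻¹' s : Set (closure s)) ≃ₜ s := ⟨⟨fun x => ⟨x, x.2⟩,
    fun x => ⟨⟨x, subset_closure x.2⟩, x.2⟩, by grind, by grind⟩, by fun_prop, by fun_prop⟩
  exact e.baireSpace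

theorem CompletelyBaire.of_homeomorph {Y Z : Type*} [TopologicalSpace Y] [TopologicalSpace Z]
    (hY : CompletelyBaire Y) (e : Y ≃ₜ Z) : CompletelyBaire Z := fun F hF =>
  have := hY (e ⁻¹' F) (hF.preimage e.continuous)
  (e.sets (s := e ⁻¹' F) (t := F) rfl).baireSpace

theorem CompletelyBaire.baireSpace {Y : Type*} [TopologicalSpace Y] (hY : CompletelyBaire Y) :
    BaireSpace Y :=
  have := hY univ isClosed_univ
  (Homeomorph.Set.univ Y).baireSpace

theorem HasDenseCompletelyMetrizableSubspace.of_homeomorph {Y Z : Type*} [TopologicalSpace Y]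
    [TopologicalSpace Z] (hY : HasDenseCompletelyMetrizableSubspace Y) (e : Y ≃ₜ Z) :
    HasDenseCompletelyMetrizableSubspace Z := by
  obtain ⟨D, hD, hDc⟩ := hY
  exact ⟨e '' D, e.surjective.denseRange.dense_image e.continuous hD,
    (e.image D).symm.isClosedEmbedding.IsCompletelyMetrizableSpace⟩

/-! ### Models of `S(X)` as sequences in `X` -/

namespace TypeSpaceFunctor

/-- The inverse limit of the powers `X ^ n` is the space of sequences in `X`. -/
def omegaHomeomorph (X : Type*) [TopologicalSpace X] : (ofSpace X).Omega ≃ₜ (ℕ → X) where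
  toFun σ i := (show Fin (i + 1) → X from σ.1 (i + 1)) (Fin.last i)
  invFun x := ⟨fun _ i => x i.1, fun _ _ _ => rfl⟩
  left_inv σ := Subtype.ext <| funext fun _ => funext fun i =>
    (congrFun (σ.2 (i + 1) _ i.2) (Fin.last i) : _)
  right_inv _ := rfl
  continuous_toFun := continuous_pi fun i =>
    (continuous_apply (A := fun _ : Fin (i + 1) => X) (Fin.last i)).comp
      ((continuous_apply (A := (ofSpace X).obj) (i + 1)).comp continuous_subtype_val)
  continuous_invFun := Continuous.subtype_mk (continuous_pi fun n =>
    (continuous_pi fun i => continuous_apply i.1 : Continuous fun x : ℕ → X => fun i : Fin n => x i))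
    _

theorem modelOf_ofSpace {X : Type*} [TopologicalSpace X] (σ : (ofSpace X).Omega) (n : ℕ)
    (a : Fin n ↪o ℕ) : (ofSpace X).modelOf σ n a = omegaHomeomorph X σ ∘ a := by
  conv_lhs => rw [← (omegaHomeomorph X).symm_apply_apply σ]
  rfl

theorem mem_W_ofSpace_iff {X : Type*} [TopologicalSpace X] (σ : (ofSpace X).Omega) :
    σ ∈ (ofSpace X).W ↔ ∀ V : Set X, IsOpen V → V.Nonempty →
      ∃ᶠ i in Filter.atTop, omegaHomeomorph X σ i ∈ V := by
  constructor
  · intro h V hV ⟨v, hv⟩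
    rw [Filter.frequently_atTop]
    intro N
    -- The one new element over `{0, …, N - 1}` must have index at least `N`, by injectivity of `b ∘
    -- g`.
    obtain ⟨b, g, hbg, hU⟩ := h.witness N.le_succ (initialSegment N)
      ((fun p : Fin (N + 1) → X => p (Fin.last N)) ⁻¹' V)
      (hV.preimage (continuous_apply (A := fun _ : Fin (N + 1) => X) (Fin.last N)))
      ⟨Fin.snoc (α := fun _ => X) (omegaHomeomorph X σ ∘ initialSegment N) v, by
        change Fin.snoc (α := fun _ => X) (omegaHomeomorph X σ ∘ initialSegment N) v (Fin.last N) ∈ V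
        rwa [Fin.snoc_last], by
        rw [modelOf_ofSpace]
        exact Fin.init_snoc (α := fun _ => X) v (omegaHomeomorph X σ ∘ initialSegment N)⟩
    rw [modelOf_ofSpace] at hU
    refine ⟨b (g (Fin.last N)), ?_, hU⟩
    by_contra! hlt
    have h1 := hbg ⟨_, hlt⟩
    have h2 := g.injective (b.injective h1)
    have h3 := congrArg Fin.val h2
    simp at h3
    omega
  · intro h
    refine ⟨?_, ?_⟩
    · intro n m a b g hab
      rw [modelOf_ofSpace, modelOf_ofSpace]
      exact funext fun i => congrArg (omegaHomeomorph X σ) (hab i)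
    · intro n m hnm a U hU ⟨p, hpU, hp⟩
      rw [modelOf_ofSpace] at hp
      change Fin m → X at p
      obtain ⟨V, hV, hVU⟩ := isOpen_pi_iff'.1 (show IsOpen (X := Fin m → X) U from hU) p hpU
      -- Distinct new indices beyond the range of `a`, the `j`-th visiting `V j`; for `j ≥ m` there
      -- is nothing to visit.
      obtain ⟨e, he, heV⟩ := Filter.extraction_forall_of_frequently
        (P := fun j k => bound a ≤ k ∧ ∀ hj : j < m, omegaHomeomorph X σ k ∈ V ⟨j, hj⟩) (by
          intro j
          by_cases hj : j < m
          · exact ((h (V ⟨j, hj⟩) (hV _).1 ⟨_, (hV _).2⟩).and_eventually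
              (Filter.eventually_ge_atTop (bound a))).mono fun k hk => ⟨hk.2, fun _ => hk.1⟩
          · exact ((Filter.eventually_ge_atTop (bound a)).mono
              fun k hk => ⟨hk, fun hj' => absurd hj' hj⟩).frequently)
      let f : Fin m → ℕ := fun j => if hj : j.1 < n then a ⟨j, hj⟩ else e j
      have hf : Function.Injective f := by
        intro i j hij
        by_cases hi : i.1 < n <;> by_cases hj : j.1 < n <;> simp only [f, hi, hj, dite_true,
          dite_false] at hij
        · exact Fin.ext (congrArg Fin.val (a.injective hij) :)
        · have := lt_bound a ⟨i, hi⟩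
          have := (heV j).1
          omega
        · have := lt_bound a ⟨j, hj⟩
          have := (heV i).1
          omega
        · exact Fin.ext (he.injective hij)
      refine ⟨OrderEmbedding.ofStrictMono (f ∘ Tuple.sort f)
        ((Tuple.monotone_sort f).strictMono_of_injective (hf.comp (Equiv.injective _))),
        (Tuple.sort f)⁻¹, fun i => ?_, ?_⟩
      · simp [f]
      · rw [modelOf_ofSpace]
        refine hVU fun j _ => ?_
        change omegaHomeomorph X σ (f (Tuple.sort f ((Tuple.sort f)⁻¹ j))) ∈ V j
        rw [show Tuple.sort f ((Tuple.sort f)⁻¹ j) = j from (Tuple.sort f).apply_symm_apply j]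
        by_cases hj : j.1 < n
        · have : p j = omegaHomeomorph X σ (a ⟨j, hj⟩) := congrFun hp ⟨j, hj⟩
          simp only [f, hj, dite_true, ← this]
          exact (hV j).2
        · simp only [f, hj, dite_false]
          exact (heV j).2 j.2

theorem isGδ_W_ofSpace (X : Type*) [TopologicalSpace X] [SecondCountableTopology X] :
    IsGδ (ofSpace X).W := by
  have : (ofSpace X).W = ⋂ V ∈ countableBasis X, ⋂ N : ℕ, ⋃ i ≥ N,
      {σ | omegaHomeomorph X σ i ∈ V} := by
    ext σ
    simp only [mem_W_ofSpace_iff, Filter.frequently_atTop, mem_iInter, mem_iUnion, exists_prop]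
    constructor
    · exact fun h V hV N => h V (isOpen_of_mem_countableBasis hV)
        (nonempty_of_mem_countableBasis hV) N
    · intro h V hV ⟨v, hv⟩ N
      obtain ⟨B, hB, -, hBV⟩ := (isBasis_countableBasis X).exists_subset_of_mem_open hv hV
      obtain ⟨i, hi, hiB⟩ := h B hB N
      exact ⟨i, hi, hBV hiB⟩
  rw [this]
  refine IsGδ.biInter (countable_countableBasis X) fun V hV => IsGδ.iInter fun N =>
    IsOpen.isGδ (isOpen_biUnion fun i _ => ?_)
  exact (isOpen_of_mem_countableBasis hV).preimage
    ((continuous_apply i).comp (omegaHomeomorph X).continuous)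

theorem dense_W_ofSpace (X : Type*) [TopologicalSpace X] [SeparableSpace X] :
    Dense (ofSpace X).W := by
  intro σ
  set x := omegaHomeomorph X σ with hx
  have : Nonempty X := ⟨x 0⟩
  -- Past `N`, unpairing repeats every term of a dense sequence infinitely often.
  let y : ℕ → ℕ → X := fun N i => if i < N then x i else denseSeq X i.unpair.2
  have hy : Filter.Tendsto y Filter.atTop (𝓝 x) := by
    refine tendsto_pi_nhds.2 fun i => tendsto_const_nhds.congr' ?_
    filter_upwards [Filter.eventually_gt_atTop i] with N hN
    simp [y, hN]
  refine mem_closure_of_tendsto (f := fun N => (omegaHomeomorph X).symm (y N)) (b := Filter.atTop)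
    ?_ (Filter.Eventually.of_forall fun N => (mem_W_ofSpace_iff _).2 fun V hV hVn => ?_)
  · have := ((omegaHomeomorph X).symm.continuous.tendsto x).comp hy
    rwa [hx, Homeomorph.symm_apply_apply] at this
  · rw [Homeomorph.apply_symm_apply, Filter.frequently_atTop]
    intro M
    obtain ⟨k, hk⟩ := (denseRange_denseSeq X).exists_mem_open hV hVn
    refine ⟨Nat.pair (max M N) k, (le_max_left _ _).trans (Nat.left_le_pair _ _), ?_⟩
    have : ¬ Nat.pair (max M N) k < N :=
      not_lt.2 ((le_max_right M N).trans (Nat.left_le_pair _ _))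
    simpa [y, this] using hk

/-! ### The two omitting types properties -/

theorem omissible_iff (S : TypeSpaceFunctor) (C F : Set S.Omega) :
    S.Omissible C F ↔ ∃ σ ∈ S.W, σ ∈ C ∧ σ ∉ F := by
  simp only [Omissible, mem_W_iff]
  constructor
  · rintro ⟨M, h⟩
    exact ⟨_, ⟨M, rfl⟩, h⟩
  · rintro ⟨_, ⟨M, rfl⟩, h⟩
    exact ⟨M, h⟩

/-- If `W` is a Gδ set and the space of `ω`-types is completely Baire, then strong omitting types
holds. -/
theorem strongOmittingTypes_of_isGδ {S : TypeSpaceFunctor} (hW : IsGδ S.W)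
    (hS : CompletelyBaire S.Omega) (hclosed : ∀ C : Set S.Omega, IsClosed C → IsGδ C) :
    S.StrongOmittingTypes := by
  intro C hC hne E _ hE
  have : BaireSpace ↥(C ∩ S.W) := hS.baireSpace_of_isGδ ((hclosed C hC).inter hW)
  have : Nonempty ↥(C ∩ S.W) := hne.to_subtype
  obtain ⟨x, hx⟩ := (dense_of_mem_residual hE).nonempty
  obtain ⟨M, hM⟩ := (S.mem_W_iff x.1).1 x.2.2
  exact ⟨M, hM ▸ x.2.1, hM ▸ hx⟩

/-- A winning strategy in the omitting types game on the whole space of `ω`-types gives a dense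
completely metrizable subspace, if all nonempty open sets are realized by models. -/
theorem OmitStrategy.IsWinning.hasDenseCompletelyMetrizableSubspace {S : TypeSpaceFunctor}
    [MetrizableSpace S.Omega] [BaireSpace S.Omega] [Nonempty S.Omega] (hW : Dense S.W)
    {τ : S.OmitStrategy univ} (hτ : τ.IsWinning) :
    HasDenseCompletelyMetrizableSubspace S.Omega := by
  have homiss : ∀ F : Set S.Omega, IsClosed F → Fᶜ.Nonempty → S.Omissible univ F := by
    intro F hF hne
    obtain ⟨σ, hσ, hσW⟩ := hW.inter_open_nonempty _ hF.isOpen_compl hne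
    exact (S.omissible_iff _ _).2 ⟨σ, hσW, mem_univ _, hσ⟩
  have hne : ∀ F : S.Move univ, F.1ᶜ.Nonempty := by
    intro F
    obtain ⟨σ, -, -, hσ⟩ := (S.omissible_iff _ _).1 F.2.2
    exact ⟨σ, hσ⟩
  have hreply : ∀ (n : ℕ) (R R' : ℕ → S.Move univ), (∀ i ≤ n, R i = R' i) →
      τ.reply R n = τ.reply R' n := by
    intro n R R' h
    exact congrArg (τ n) (funext fun i => h i (Nat.le_of_lt_succ i.2))
  let r₀ : S.Move univ := ⟨∅, isClosed_empty, homiss _ isClosed_empty (by simp)⟩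
  -- A position is a legal finite play, given by its length and a sequence whose values beyond that
  -- length are junk.
  let P := {p : ℕ × (ℕ → S.Move univ) // ∀ k, k + 1 < p.1 → (τ.reply p.2 k).1 ⊆ (p.2 (k + 1)).1}
  let V : P → Set S.Omega := fun p => ⋂ k ∈ Finset.range p.1.1, (τ.reply p.1.2 k).1ᶜ
  let child : P → P → Prop := fun p q => q.1.1 = p.1.1 + 1 ∧ ∀ i < p.1.1, q.1.2 i = p.1.2 i
  have hV : ∀ (p : P) (σ : S.Omega), σ ∈ V p ↔ ∀ k < p.1.1, σ ∉ (τ.reply p.1.2 k).1 := by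
    simp [V]
  let root : P := ⟨(0, fun _ => r₀), by simp⟩
  refine hasDenseCompletelyMetrizableSubspace_of_choquet V child root
    (by simp [V, root])
    (fun p => isOpen_biInter_finset fun k _ => (τ.reply p.1.2 k).2.1.isOpen_compl) ?_ ?_ ?_
  · rintro p q ⟨hlen, hagree⟩ σ hσ
    rw [hV] at hσ ⊢
    intro k hk
    rw [hreply k p.1.2 q.1.2 fun i hi => (hagree i (by omega)).symm]
    exact hσ k (by omega)
  · rintro ⟨⟨n, R⟩, hR⟩ U hU hUne hUV
    have hUV' : ∀ σ ∈ U, ∀ k < n, σ ∉ (τ.reply R k).1 := fun σ hσ => (hV _ _).1 (hUV hσ)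
    -- REALIZE answers with the complement of `U`; this is legal because `U` misses all earlier
    -- replies.
    let u : S.Move univ :=
      ⟨Uᶜ, hU.isClosed_compl, homiss _ hU.isClosed_compl (by rwa [compl_compl])⟩
    let R' : ℕ → S.Move univ := fun i => if i < n then R i else u
    have hagree : ∀ i < n, R' i = R i := fun i hi => if_pos hi
    have hrep : ∀ k < n, τ.reply R' k = τ.reply R k := fun k hk =>
      hreply k _ _ fun i hi => hagree i (by omega)
    have hlegal : ∀ k < n, (τ.reply R' k).1 ⊆ (R' (k + 1)).1 := by
      intro k hk
      rw [hrep k hk]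
      by_cases hk' : k + 1 < n
      · rw [hagree _ hk']
        exact hR k hk'
      · rw [show R' (k + 1) = u from if_neg hk']
        exact fun σ hσ hσU => hUV' σ hσU k hk hσ
    have hlast : Uᶜ ⊆ (τ.reply R' n).1 := by
      have := (hτ R').1 n hlegal
      rwa [show R' n = u from if_neg (lt_irrefl n)] at this
    refine ⟨⟨(n + 1, R'), fun k hk => hlegal k (by simpa using hk)⟩, ⟨rfl, hagree⟩, ?_, ?_⟩
    · intro σ hσ
      by_contra hσU
      exact (hV _ _).1 hσ n n.lt_succ_self (hlast hσU)
    · obtain ⟨σ, hσ⟩ := hne (τ.reply R' n)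
      refine ⟨σ, (hV _ _).2 fun k hk => ?_⟩
      rcases Nat.lt_succ_iff_lt_or_eq.1 hk with hk | rfl
      · change σ ∉ (τ.reply R' k).1
        rw [hrep k hk]
        exact hUV' σ (not_not.1 fun h => hσ (hlast h)) k hk
      · exact hσ
  · intro b hb0 hb
    have hlen : ∀ n, (b n).1.1 = n := by
      intro n
      induction n with
      | zero => rw [hb0]
      | succ n ih => rw [(hb n).1, ih]
    -- Move `n` first counts at position `n + 1`, and later positions keep it.
    let R : ℕ → S.Move univ := fun n => (b (n + 1)).1.2 n
    have hbR : ∀ n, ∀ i < n, (b n).1.2 i = R i := by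
      intro n
      induction n with
      | zero => exact fun i hi => absurd hi i.not_lt_zero
      | succ n ih =>
        intro i hi
        rcases Nat.lt_succ_iff_lt_or_eq.1 hi with hi | rfl
        · rw [(hb n).2 i (by rwa [hlen]), ih i hi]
        · rfl
    have hrep : ∀ n, ∀ k < n, τ.reply (b n).1.2 k = τ.reply R k := fun n k hk =>
      hreply k _ _ fun i hi => hbR n i (by omega)
    have hlegal : ∀ k, (τ.reply R k).1 ⊆ (R (k + 1)).1 := by
      intro k
      have := (b (k + 2)).2 k (by rw [hlen]; omega)
      rwa [hrep (k + 2) k (by omega), hbR (k + 2) (k + 1) (by omega)] at this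
    obtain ⟨σ, -, -, hσ⟩ := (S.omissible_iff _ _).1 ((hτ R).2 hlegal)
    refine ⟨σ, fun n => (hV _ _).2 fun k hk hσk => hσ ?_⟩
    rw [hlen] at hk
    rw [hrep n k hk] at hσk
    exact mem_iUnion.2 ⟨k, Or.inr hσk⟩

end TypeSpaceFunctor

theorem mainTheorem7 {X : Type u} [TopologicalSpace X] [TopologicalSpace.SeparableSpace X]
    [TopologicalSpace.MetrizableSpace X]
    (hBaire : CompletelyBaire (ℕ → X))
    (hDense : ¬ HasDenseCompletelyMetrizableSubspace (ℕ → X)) :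
    (TypeSpaceFunctor.ofSpace X).StrongOmittingTypes ∧
      ¬ (TypeSpaceFunctor.ofSpace X).GameOmittingTypes := by
  let e := TypeSpaceFunctor.omegaHomeomorph X
  have : SecondCountableTopology X :=
    let _ := pseudoMetrizableSpacePseudoMetric X
    UniformSpace.secondCountable_of_separable X
  have : MetrizableSpace (TypeSpaceFunctor.ofSpace X).Omega := e.isEmbedding.metrizableSpace
  have hΩ : CompletelyBaire (TypeSpaceFunctor.ofSpace X).Omega := hBaire.of_homeomorph e.symm
  have : BaireSpace (TypeSpaceFunctor.ofSpace X).Omega := hΩ.baireSpace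
  refine ⟨TypeSpaceFunctor.strongOmittingTypes_of_isGδ (TypeSpaceFunctor.isGδ_W_ofSpace X) hΩ
    fun C hC => ?_, fun hgame => ?_⟩
  · let _ := metrizableSpaceMetric (TypeSpaceFunctor.ofSpace X).Omega
    exact hC.isGδ
  -- An empty `X^ω` would itself be a dense completely metrizable subspace.
  · have : Nonempty (TypeSpaceFunctor.ofSpace X).Omega := by
      by_contra hempty
      rw [not_nonempty_iff] at hempty
      have : IsEmpty (ℕ → X) := e.symm.toEquiv.isEmpty
      exact hDense ⟨univ, dense_univ, inferInstance⟩
    obtain ⟨τ, hτ⟩ := hgame univ isClosed_univ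
    exact hDense ((hτ.hasDenseCompletelyMetrizableSubspace
      (TypeSpaceFunctor.dense_W_ofSpace X)).of_homeomorph e)
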